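/- An instance of Adaptive Submodular Ranking consists of a finite ground set $U$ of $n$ elements with costs $c_e>0$ ($e\in U$), and $m$ scenarios $i\in[m]=\{1,\dots,m\}$, each with a probability $p_i\ge 0$ ($\sum_i p_i=1$), an interest set $S_i\subseteq U$ and a monotone submodular function $f_i:2^{S_i}\to[0,1]$ with $f_i(\emptyset)=0$ and $f_i(S_i)=1$, extended to all $A\subseteq U$ by $f_i(A)=f_i(A\cap S_i)$. Scenario $i$ is covered by $A$ if $f_i(A)=1$. A feasible solution is a finite binary decision tree whose inner nodes are labelled by elements, such that every scenario $i$ is covered by the set of elements on its root-leaf path, which takes the yes-branch at a node labelled $e$ if $e\in S_i$ and the no-branch otherwise. The cost of scenario $i$ is the total cost of the shortest prefix of its path that covers $i$, and the expected cover cost of the tree is $\sum_i p_i\cdot(\text{cost of scenario } i)$. Let $$\epsilon=\min\{f_i(A\cup\{e\})-f_i(A) : i\in[m],\ A\subseteq U,\ e\in U,\ f_i(A\cup\{e\})>f_i(A)\}.$$ The adaptive greedy algorithm maintains the set $E$ of elements displayed so far (initially $\emptyset$) and the set $H$ of scenarios that are compatible with the yes/no feedback received so far and are not covered by $E$ (initially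 $[m]$), and stops when $H=\emptyset$. Otherwise, for each $e\in U\setminus E$ it lets $L_e(H)$ be the one of the sets $\{i\in H:e\in S_i\}$, $\{i\in H:e\notin S_i\}$ that has fewer elements, and displays an element $e\in U\setminus E$ that maximizes $$\frac1{c_e}\Big(\sum_{j\in L_e(H)}p_j+\sum_{i\in H}p_i\,\frac{f_i(E\cup\{e\})-f_i(E)}{1-f_i(E)}\Big),$$ all ties being broken arbitrarily. Theorem. There is an absolute constant $C>0$ such that, for every instance, the greedy algorithm can be carried out, each decision tree that it can produce is feasible, and the expected cover cost of such a tree is at most $C\,(1+\log\frac1\epsilon+\log m)$ times the expected cover cost of any feasible decision tree, in particular of an optimal one. That is, the algorithm is an $O(\log\frac1\epsilon+\log m)$-approximation for the expected cover cost. -/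

import Mathlib

namespace ASR

/-- A binary decision tree (adaptive solution): an inner node displays an element of the ground
set and then branches on the yes/no feedback; a leaf ends the process. -/
inductive DecisionTree (U : Type*) where
  | leaf : DecisionTree U
  | node (e : U) (yes no : DecisionTree U) : DecisionTree U

/-- The sequence of elements on the root-leaf path traced by a scenario with interest set `S`:
the yes-branch is taken at elements of `S`, the no-branch at the others. -/
def DecisionTree.path {U : Type*} [DecidableEq U] (S : Finset U) : DecisionTree U → List U
  | .leaf => []
  | .node e yes no => e :: (if e ∈ S then yes.path S else no.path S)

/-- An instance of adaptive submodular ranking with ground set `U` and set of scenarios `I`.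
The function of scenario `i`, given on subsets of the interest set `interest i`, is extended to
all subsets of `U` by `f i A = f i (A ∩ interest i)`; this extension is the field `f`. -/
structure Instance (U I : Type*) [DecidableEq U] [Fintype I] where
  /-- the cost of an element -/
  cost : U → ℝ
  cost_pos : ∀ e, 0 < cost e
  /-- the interest set of a scenario -/
  interest : I → Finset U
  /-- the function of a scenario -/
  f : I → Finset U → ℝ
  f_inter : ∀ i A, f i A = f i (A ∩ interest i)
  f_mono : ∀ i A B, A ⊆ B → f i A ≤ f i B
  f_submodular : ∀ i A B, f i (A ∩ B) + f i (A ∪ B) ≤ f i A + f i B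
  f_empty : ∀ i, f i ∅ = 0
  f_interest : ∀ i, f i (interest i) = 1
  /-- the probability of a scenario -/
  prob : I → ℝ
  prob_nonneg : ∀ i, 0 ≤ prob i
  prob_sum : ∑ i, prob i = 1

namespace Instance

variable {U I : Type*} [DecidableEq U] [Fintype I]

/-- The smallest positive marginal gain of any of the functions. (For finite `U` it is the infimum
of a finite set of positive reals, which is nonempty since every `f i` increases from 0 to 1.) -/
noncomputable def minGain (P : Instance U I) : ℝ :=
  sInf {x : ℝ | ∃ (i : I) (A : Finset U) (e : U),
    P.f i A < P.f i (insert e A) ∧ x = P.f i (insert e A) - P.f i A}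

/-- A set of elements covers scenario `i` if its value is (at least) one. -/
def Covers (P : Instance U I) (i : I) (A : Finset U) : Prop := 1 ≤ P.f i A

/-- A decision tree is feasible if every scenario is covered along its path. -/
def Feasible (P : Instance U I) (T : DecisionTree U) : Prop :=
  ∀ i, P.Covers i (T.path (P.interest i)).toFinset

/-- The length of the shortest prefix of `l` that covers scenario `i`. -/
noncomputable def coverLength (P : Instance U I) (i : I) (l : List U) : ℕ :=
  sInf {k : ℕ | P.Covers i (l.take k).toFinset}

/-- The cost of scenario `i` in a (feasible) decision tree: the total cost of the shortest prefix
of its path that covers it. -/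
noncomputable def scenarioCost (P : Instance U I) (T : DecisionTree U) (i : I) : ℝ :=
  (((T.path (P.interest i)).take (P.coverLength i (T.path (P.interest i)))).map P.cost).sum

/-- The expected cover cost of a (feasible) decision tree. -/
noncomputable def expectedCost (P : Instance U I) (T : DecisionTree U) : ℝ :=
  ∑ i, P.prob i * P.scenarioCost T i

/-- The scenarios of `H` for which the feedback from element `e` is "yes". -/
def yesPart (P : Instance U I) (H : Finset I) (e : U) : Finset I :=
  H.filter (fun i => e ∈ P.interest i)

/-- The scenarios of `H` for which the feedback from element `e` is "no". -/
def noPart (P : Instance U I) (H : Finset I) (e : U) : Finset I :=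
  H.filter (fun i => e ∉ P.interest i)

/-- `L` is a choice of the set `L_e(H)`: the one of the two parts of `H` with the smaller number of
scenarios (either one in case of a tie). -/
def IsSmallerPart (P : Instance U I) (H : Finset I) (e : U) (L : Finset I) : Prop :=
  (L = P.yesPart H e ∧ (P.yesPart H e).card ≤ (P.noPart H e).card) ∨
  (L = P.noPart H e ∧ (P.noPart H e).card ≤ (P.yesPart H e).card)

/-- The score of element `e` at the state `(E, H)`, with `L` in the role of `L_e(H)`. -/
noncomputable def score (P : Instance U I) (E : Finset U) (H L : Finset I) (e : U) : ℝ :=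
  1 / P.cost e * (∑ j ∈ L, P.prob j +
    ∑ i ∈ H, P.prob i * ((P.f i (insert e E) - P.f i E) / (1 - P.f i E)))

/-- `e` is a possible selection of the greedy algorithm at the state `(E, H)`: a remaining element
of maximum score. Ties, in the choice of the sets `L_e(H)` and in the maximum, are broken
arbitrarily. -/
def IsGreedyChoice (P : Instance U I) (E : Finset U) (H : Finset I) (e : U) : Prop :=
  ∃ L : U → Finset I, (∀ e', P.IsSmallerPart H e' (L e')) ∧
    e ∉ E ∧ ∀ e', e' ∉ E → P.score E H (L e') e' ≤ P.score E H (L e) e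

open Classical in
/-- The scenarios of `K` that the set `E` does not cover. -/
noncomputable def uncovered (P : Instance U I) (E : Finset U) (K : Finset I) : Finset I :=
  K.filter (fun i => ¬ P.Covers i E)

/-- `P.GreedyFrom E H T`: `T` is a decision tree that the greedy algorithm may produce from the
state `(E, H)`, where `E` is the set of displayed elements and `H` the set of scenarios that are
compatible with the feedback so far and still uncovered. -/
inductive GreedyFrom (P : Instance U I) : Finset U → Finset I → DecisionTree U → Prop
  | done (E : Finset U) : GreedyFrom P E ∅ .leaf
  | step (E : Finset U) (H : Finset I) (e : U) (yes no : DecisionTree U)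
      (hH : H.Nonempty) (he : P.IsGreedyChoice E H e)
      (hyes : GreedyFrom P (insert e E) (P.uncovered (insert e E) (P.yesPart H e)) yes)
      (hno : GreedyFrom P (insert e E) (P.uncovered (insert e E) (P.noPart H e)) no) :
      GreedyFrom P E H (.node e yes no)

/-- `T` is a decision tree produced by the greedy algorithm: initially nothing is displayed and
all scenarios are possible (and uncovered). -/
def IsGreedyTree (P : Instance U I) (T : DecisionTree U) : Prop :=
  P.GreedyFrom ∅ Finset.univ T

end Instance

end ASR

namespace ASR

namespace Instance

/-! ### Covering and the cost along a path -/

section General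

variable {U I : Type*} [DecidableEq U] [Fintype I]

/-! Compare the greedy tree with a feasible tree `T`, and let scenario `i` cost `a i` in the former
and `o i` in the latter. Suppose greedy, having spent `s`, displays `e` at the state `(E, H)` and so
reaches `t = s + cost e`.

For every budget `B`, the score of `e` times `B` is at least the probability of the scenarios of `H`
with `o i ≤ B` (`sum_prob_le_mul_score`). Indeed, follow in `T`, up to cost `B`, the path that
always sides with the larger part of `H`. Each such scenario either leaves this path, and so lies in
a smaller part `L`, or is covered by its elements, whose relative gains then sum to at least 1 by
submodularity. Hence the elements of the path have large scores on average, and greedy maximizes the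
score.

Take `B = t / r`. The amount `cost e`, paid by all of `H`, is charged thus: scenarios with `o i > t
/ r` pay it themselves, and the others are paid for by `t / r` times the total gain of `e`. Along
the path of `i`, charges of the first kind add up to at most `r * o i`; those of the second kind to
at most `a i / r` times the total gain of `i`, since `t ≤ a i`. That gain is logarithmic: lying in
`L` halves `H`, and relative gains telescope into the logarithm of `1 - f`. The induction is
`greedyFrom_cost_le`. With `r` four times the logarithmic factor, the second kind is at most half of
the greedy cost and can be absorbed. -/

theorem f_le_one (P : Instance U I) (i : I) (A : Finset U) : P.f i A ≤ 1 := by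
  rw [P.f_inter, ← P.f_interest i]
  exact P.f_mono _ _ _ Finset.inter_subset_right

theorem Covers.mono {P : Instance U I} {i : I} {A B : Finset U} (h : P.Covers i A) (hAB : A ⊆ B) :
    P.Covers i B :=
  le_trans h (P.f_mono i A B hAB)

theorem not_covers_empty (P : Instance U I) (i : I) : ¬ P.Covers i ∅ := by
  simp [Covers, P.f_empty]

theorem covers_of_interest_subset (P : Instance U I) {i : I} {A : Finset U}
    (h : P.interest i ⊆ A) : P.Covers i A :=
  Covers.mono (P.f_interest i).ge h

/-- Submodularity bounds a joint gain by the sum of the single gains. -/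
theorem gain_union_le (P : Instance U I) (i : I) (E Q : Finset U) :
    P.f i (E ∪ Q) - P.f i E ≤ ∑ e ∈ Q, (P.f i (insert e E) - P.f i E) := by
  induction Q using Finset.induction_on with
  | empty => simp
  | insert e Q he ih =>
    rw [Finset.sum_insert he]
    have h := P.f_submodular i (insert e E) (E ∪ Q)
    have h1 : insert e E ∪ (E ∪ Q) = E ∪ insert e Q := by
      ext x; simp only [Finset.mem_union, Finset.mem_insert]; tauto
    have h2 : P.f i E ≤ P.f i (insert e E ∩ (E ∪ Q)) :=
      P.f_mono i _ _ (Finset.subset_inter (Finset.subset_insert _ _) Finset.subset_union_left)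
    rw [h1] at h
    linarith

theorem mem_uncovered {P : Instance U I} {E : Finset U} {K : Finset I} {i : I} :
    i ∈ P.uncovered E K ↔ i ∈ K ∧ ¬ P.Covers i E := by
  classical
  simp [uncovered]

open Classical in
/-- The cost, along the elements of a list, until scenario `i` is covered, when the elements of
`A` are already displayed. -/
noncomputable def costFrom (P : Instance U I) (i : I) : Finset U → List U → ℝ
  | _, [] => 0
  | A, e :: l => if P.Covers i A then 0 else P.cost e + costFrom P i (insert e A) l

theorem costFrom_nonneg (P : Instance U I) (i : I) (A : Finset U) (l : List U) :
    0 ≤ P.costFrom i A l := by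
  induction l generalizing A with
  | nil => simp [costFrom]
  | cons e l ih =>
    rw [costFrom]
    split_ifs
    · exact le_rfl
    · exact add_nonneg (P.cost_pos e).le (ih _)

theorem costFrom_of_covers (P : Instance U I) {i : I} {A : Finset U} (h : P.Covers i A)
    (l : List U) : P.costFrom i A l = 0 := by
  cases l <;> simp [costFrom, h]

theorem sum_take_eq_costFrom (P : Instance U I) (i : I) (A : Finset U) (l : List U)
    (h : P.Covers i (A ∪ l.toFinset)) :
    ((l.take (sInf {k : ℕ | P.Covers i (A ∪ (l.take k).toFinset)})).map P.cost).sum =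
      P.costFrom i A l := by
  induction l generalizing A with
  | nil => simp [costFrom]
  | cons e l ih =>
    by_cases hA : P.Covers i A
    · have h0 : sInf {k : ℕ | P.Covers i (A ∪ ((e :: l).take k).toFinset)} = 0 :=
        Nat.sInf_eq_zero.2 (Or.inl (by simpa using hA))
      rw [h0, costFrom_of_covers P hA]
      simp
    · have hu : ∀ k : List U, A ∪ (e :: k).toFinset = insert e A ∪ k.toFinset := fun k => by
        ext x; simp only [List.toFinset_cons, Finset.mem_union, Finset.mem_insert]; tauto
      have hne : {k : ℕ | P.Covers i (A ∪ ((e :: l).take k).toFinset)}.Nonempty :=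
        ⟨(e :: l).length, by simpa using h⟩
      have hpos : 1 ≤ sInf {k : ℕ | P.Covers i (A ∪ ((e :: l).take k).toFinset)} := by
        rw [Nat.one_le_iff_ne_zero]
        intro h0
        have := Nat.sInf_mem hne
        rw [h0] at this
        exact hA (by simpa using this)
      -- As the empty prefix does not cover, the least index is a successor, and `e` can be split
      -- off.
      have hs := Nat.sInf_add hpos
      rw [← hs]
      simp only [List.take_succ_cons, List.map_cons, List.sum_cons, hu]
      rw [ih (insert e A) (by rwa [← hu]), costFrom, if_neg hA]

theorem scenarioCost_eq_costFrom (P : Instance U I) {T : DecisionTree U} (hT : P.Feasible T)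
    (i : I) : P.scenarioCost T i = P.costFrom i ∅ (T.path (P.interest i)) := by
  rw [← sum_take_eq_costFrom P i ∅ _ (by simpa using hT i)]
  simp [scenarioCost, coverLength]

/-! ### Following a path within a budget -/

/-- The longest prefix of a list whose total cost does not exceed the budget `B`. -/
noncomputable def affordablePrefix (c : U → ℝ) : ℝ → List U → List U
  | _, [] => []
  | B, e :: l => if c e ≤ B then e :: affordablePrefix c (B - c e) l else []

theorem sum_affordablePrefix_le (P : Instance U I) {B : ℝ} (hB : 0 ≤ B) (l : List U) :
    ∑ e ∈ (affordablePrefix P.cost B l).toFinset, P.cost e ≤ B := by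
  induction l generalizing B with
  | nil => simpa [affordablePrefix] using hB
  | cons e l ih =>
    rw [affordablePrefix]
    split_ifs with h
    · have := ih (sub_nonneg.2 h)
      rw [List.toFinset_cons]
      -- A repeated element uses up budget each time but counts once in the set.
      by_cases hm : e ∈ (affordablePrefix P.cost (B - P.cost e) l).toFinset
      · rw [Finset.insert_eq_of_mem hm]
        linarith [P.cost_pos e]
      · rw [Finset.sum_insert hm]
        linarith
    · simpa using hB

/-- A scenario that a tree covers within the budget is covered by the affordable prefix of any
given path of the tree, unless it leaves that path at an element of the prefix. -/
theorem covers_or_leaves (P : Instance U I) (i : I) (S : Finset U) (T : DecisionTree U)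
    (A : Finset U) (B : ℝ) (hcov : P.Covers i (A ∪ (T.path (P.interest i)).toFinset))
    (hB : P.costFrom i A (T.path (P.interest i)) ≤ B) :
    P.Covers i (A ∪ (affordablePrefix P.cost B (T.path S)).toFinset) ∨
      ∃ e ∈ (affordablePrefix P.cost B (T.path S)).toFinset, ¬ (e ∈ P.interest i ↔ e ∈ S) := by
  induction T generalizing A B with
  | leaf => left; simpa [DecisionTree.path, affordablePrefix] using hcov
  | node e yes no ihy ihn =>
    by_cases hA : P.Covers i A
    · exact Or.inl (hA.mono Finset.subset_union_left)
    · have hu : ∀ k : List U, A ∪ (e :: k).toFinset = insert e A ∪ k.toFinset := fun k => by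
        ext x; simp only [List.toFinset_cons, Finset.mem_union, Finset.mem_insert]; tauto
      simp only [DecisionTree.path] at hcov hB ⊢
      rw [costFrom, if_neg hA] at hB
      rw [hu] at hcov
      have h0 := P.costFrom_nonneg i (insert e A)
        (if e ∈ P.interest i then yes.path (P.interest i) else no.path (P.interest i))
      -- While `i` is uncovered, the cost of `e` is part of what `i` pays, hence affordable. So the
      -- element at which `i` leaves still belongs to the prefix.
      rw [affordablePrefix, if_pos (by linarith), hu]
      by_cases he : e ∈ P.interest i ↔ e ∈ S
      · have key : ∀ T' : DecisionTree U, P.Covers i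
            (insert e A ∪ (affordablePrefix P.cost (B - P.cost e) (T'.path S)).toFinset) ∨
            (∃ e' ∈ (affordablePrefix P.cost (B - P.cost e) (T'.path S)).toFinset,
              ¬ (e' ∈ P.interest i ↔ e' ∈ S)) →
            P.Covers i
            (insert e A ∪ (affordablePrefix P.cost (B - P.cost e) (T'.path S)).toFinset) ∨
            (∃ e' ∈ (e :: affordablePrefix P.cost (B - P.cost e) (T'.path S)).toFinset,
              ¬ (e' ∈ P.interest i ↔ e' ∈ S)) := by
          rintro T' (h | ⟨e', h, h'⟩)
          · exact Or.inl h
          · exact Or.inr ⟨e', by rw [List.toFinset_cons]; exact Finset.mem_insert_of_mem h, h'⟩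
        by_cases hS : e ∈ P.interest i
        · have hS' := he.1 hS
          simp only [if_pos hS, if_pos hS'] at hcov hB ⊢
          exact key yes (ihy _ _ hcov (by linarith))
        · have hS' : e ∉ S := fun h => hS (he.2 h)
          simp only [if_neg hS, if_neg hS'] at hcov hB ⊢
          exact key no (ihn _ _ hcov (by linarith))
      · exact Or.inr ⟨e, by simp, he⟩

/-! ### The smaller part and the greedy score -/

theorem IsSmallerPart.subset {P : Instance U I} {H L : Finset I} {e : U}
    (h : P.IsSmallerPart H e L) : L ⊆ H := by
  rcases h with ⟨rfl, _⟩ | ⟨rfl, _⟩ <;> exact Finset.filter_subset _ _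

theorem card_yesPart_add_card_noPart (P : Instance U I) (H : Finset I) (e : U) :
    (P.yesPart H e).card + (P.noPart H e).card = H.card :=
  Finset.card_filter_add_card_filter_not _

/-- Applied to elements already displayed, on whose feedback all of `H` agrees: they have score
zero, so a comparison path may contain them. -/
theorem IsSmallerPart.eq_empty {P : Instance U I} {H L : Finset I} {e : U}
    (h : P.IsSmallerPart H e L)
    (hom : ∀ i ∈ H, ∀ j ∈ H, e ∈ P.interest i ↔ e ∈ P.interest j) : L = ∅ := by
  have hem : P.yesPart H e = ∅ ∨ P.noPart H e = ∅ := by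
    by_contra hcon
    obtain ⟨⟨i, hi⟩, ⟨j, hj⟩⟩ := (not_or.1 hcon).imp Finset.nonempty_iff_ne_empty.2
      Finset.nonempty_iff_ne_empty.2
    simp only [yesPart, noPart, Finset.mem_filter] at hi hj
    exact hj.2 ((hom i hi.1 j hj.1).1 hi.2)
  rcases h with ⟨rfl, h⟩ | ⟨rfl, h⟩ <;> rcases hem with h' | h'
  · exact h'
  · simpa [h'] using h
  · simpa [h'] using h
  · exact h'

theorem gain_nonneg (P : Instance U I) (i : I) (E : Finset U) (e : U) :
    0 ≤ (P.f i (insert e E) - P.f i E) / (1 - P.f i E) :=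
  div_nonneg (sub_nonneg.2 (P.f_mono i _ _ (Finset.subset_insert _ _)))
    (sub_nonneg.2 (P.f_le_one i E))

open Classical in
-- Splits the score into shares of single scenarios, so that it can be charged to them.
theorem cost_mul_score (P : Instance U I) (E : Finset U) {H L : Finset I} (e : U) (hL : L ⊆ H) :
    P.cost e * P.score E H L e = ∑ i ∈ H, P.prob i *
      ((if i ∈ L then 1 else 0) + (P.f i (insert e E) - P.f i E) / (1 - P.f i E)) := by
  rw [score, ← mul_assoc, mul_one_div_cancel (P.cost_pos e).ne', one_mul]
  simp only [mul_add, Finset.sum_add_distrib, mul_ite, mul_one, mul_zero]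
  rw [Finset.sum_ite_mem, Finset.inter_eq_right.2 hL]

theorem score_nonneg (P : Instance U I) (E : Finset U) (H L : Finset I) (e : U) :
    0 ≤ P.score E H L e :=
  mul_nonneg (one_div_nonneg.2 (P.cost_pos e).le)
    (add_nonneg (Finset.sum_nonneg fun i _ => P.prob_nonneg i)
      (Finset.sum_nonneg fun i _ => mul_nonneg (P.prob_nonneg i) (P.gain_nonneg i E e)))

/-- The greedy score, times a budget `B`, is at least the probability of those scenarios
that a feasible tree covers within cost `B`. -/
theorem sum_prob_le_mul_score (P : Instance U I) {E : Finset U} {H : Finset I}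
    (hH : ∀ i ∈ H, ¬ P.Covers i E)
    (hom : ∀ e ∈ E, ∀ i ∈ H, ∀ j ∈ H, e ∈ P.interest i ↔ e ∈ P.interest j)
    {L : U → Finset I} (hL : ∀ e, P.IsSmallerPart H e (L e)) {M : ℝ} (hM0 : 0 ≤ M)
    (hM : ∀ e, e ∉ E → P.score E H (L e) e ≤ M)
    {T : DecisionTree U} (hT : P.Feasible T) {B : ℝ} (hB : 0 ≤ B) :
    ∑ i ∈ H with P.scenarioCost T i ≤ B, P.prob i ≤ B * M := by
  classical
  -- `S'` plays a fictitious scenario that answers with the larger part of `H`, so that leaving its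
  -- path means lying in `L e`. Only elements of interest sets need a yes-answer, which keeps it
  -- finite.
  let S : Finset U := (T.path ∅).toFinset ∪ Finset.univ.biUnion fun i : I => P.interest i
  let S' : Finset U := S.filter fun e => L e = P.noPart H e
  let Q : Finset U := (affordablePrefix P.cost B (T.path S')).toFinset
  have hpt : ∀ i ∈ H, P.scenarioCost T i ≤ B →
      1 ≤ ∑ e ∈ Q, ((if i ∈ L e then 1 else 0) +
        (P.f i (insert e E) - P.f i E) / (1 - P.f i E)) := by
    intro i hi hiB
    rw [P.scenarioCost_eq_costFrom hT] at hiB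
    have h1 : 0 < 1 - P.f i E := by
      have := hH i hi
      rw [Covers, not_le] at this
      linarith
    rcases P.covers_or_leaves i S' T ∅ B (by simpa using hT i) hiB with h | ⟨e, he, hne⟩
    · have h2 : 1 - P.f i E ≤ ∑ e ∈ Q, (P.f i (insert e E) - P.f i E) := by
        refine le_trans ?_ (P.gain_union_le i E Q)
        have : P.Covers i (E ∪ Q) := h.mono (by simp [Q])
        rw [Covers] at this
        linarith
      rw [Finset.sum_add_distrib, ← Finset.sum_div]
      have h3 : 1 ≤ (∑ e ∈ Q, (P.f i (insert e E) - P.f i E)) / (1 - P.f i E) := by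
        rwa [le_div_iff₀ h1, one_mul]
      have h4 : (0 : ℝ) ≤ ∑ e ∈ Q, if i ∈ L e then 1 else 0 :=
        Finset.sum_nonneg fun e _ => by split_ifs <;> norm_num
      linarith
    · have hiL : i ∈ L e := by
        rcases hL e with ⟨h, _⟩ | ⟨h, _⟩
        · rw [h]
          by_contra hn
          simp only [yesPart, Finset.mem_filter, hi, true_and] at hn
          have heS : e ∈ S' := by
            by_contra hh; exact hne (iff_of_false hn hh)
          have heq := (Finset.mem_filter.1 heS).2
          have hin : i ∈ P.noPart H e := by simp [noPart, hi, hn]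
          rw [← heq, h] at hin
          exact hn (Finset.mem_filter.1 hin).2
        · rw [h]
          by_contra hn
          simp only [noPart, Finset.mem_filter, hi, true_and, not_not] at hn
          have heS : e ∈ S' := Finset.mem_filter.2
            ⟨Finset.mem_union_right _ (Finset.mem_biUnion.2 ⟨i, Finset.mem_univ i, hn⟩), h⟩
          exact hne (iff_of_true hn heS)
      refine le_trans ?_ (Finset.single_le_sum (f := fun e => (if i ∈ L e then (1 : ℝ) else 0) +
        (P.f i (insert e E) - P.f i E) / (1 - P.f i E)) (fun e' _ => ?_) he)
      · simpa [hiL] using P.gain_nonneg i E e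
      · exact add_nonneg (by split_ifs <;> norm_num) (P.gain_nonneg i E e')
  calc ∑ i ∈ H with P.scenarioCost T i ≤ B, P.prob i
      ≤ ∑ i ∈ H with P.scenarioCost T i ≤ B, P.prob i * ∑ e ∈ Q, ((if i ∈ L e then 1 else 0) +
        (P.f i (insert e E) - P.f i E) / (1 - P.f i E)) := by
        refine Finset.sum_le_sum fun i hi => ?_
        rw [Finset.mem_filter] at hi
        exact le_mul_of_one_le_right (P.prob_nonneg i) (hpt i hi.1 hi.2)
    _ ≤ ∑ i ∈ H, P.prob i * ∑ e ∈ Q, ((if i ∈ L e then 1 else 0) +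
        (P.f i (insert e E) - P.f i E) / (1 - P.f i E)) := by
        refine Finset.sum_le_sum_of_subset_of_nonneg (Finset.filter_subset _ _) fun i _ _ => ?_
        refine mul_nonneg (P.prob_nonneg i) (Finset.sum_nonneg fun e _ => ?_)
        exact add_nonneg (by split_ifs <;> norm_num) (P.gain_nonneg i E e)
    _ = ∑ e ∈ Q, P.cost e * P.score E H (L e) e := by
        simp only [Finset.mul_sum]
        rw [Finset.sum_comm]
        exact Finset.sum_congr rfl fun e _ => (P.cost_mul_score E e (hL e).subset).symm
    _ ≤ ∑ e ∈ Q, P.cost e * M := by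
        refine Finset.sum_le_sum fun e _ => mul_le_mul_of_nonneg_left ?_ (P.cost_pos e).le
        by_cases he : e ∈ E
        · have : P.score E H (L e) e = 0 := by
            simp [score, (hL e).eq_empty (hom e he), Finset.insert_eq_of_mem he]
          rwa [this]
        · exact hM e he
    _ = (∑ e ∈ Q, P.cost e) * M := (Finset.sum_mul _ _ _).symm
    _ ≤ B * M := mul_le_mul_of_nonneg_right (P.sum_affordablePrefix_le hB _) hM0

/-! ### Charging the greedy cost to a potential -/

/-- A scenario in the smaller part has its number of competitors halved. -/
theorem two_mul_log_card_le {h h' : ℕ} {l : ℝ} (h0 : 0 < h') (hle : h' ≤ h)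
    (hl : l = 0 ∨ l = 1 ∧ 2 * h' ≤ h) : l + 2 * Real.log h' ≤ 2 * Real.log h := by
  have h0' : (0 : ℝ) < h' := by exact_mod_cast h0
  rcases hl with rfl | ⟨rfl, hl⟩
  · have := Real.log_le_log h0' (by exact_mod_cast hle : (h' : ℝ) ≤ h)
    linarith
  · have := Real.log_le_log (by positivity) (by exact_mod_cast hl : (2 : ℝ) * h' ≤ h)
    rw [Real.log_mul two_ne_zero h0'.ne'] at this
    -- The factor 2 is there because `2 * log 2 ≥ 1`.
    linarith [Real.log_two_gt_d9]

/-- This is `log (y / x) ≤ y / x - 1`. With `x`, `y` the deficits `1 - f` before and after a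
display, it makes relative gains telescope. -/
theorem log_add_gain_le {x y ε : ℝ} (hx : 0 < x) (hy : 0 < y) (hε : 0 < ε) :
    Real.log (y / ε) + (x - y) / x ≤ Real.log (x / ε) := by
  have h := Real.log_le_sub_one_of_pos (div_pos hy hx)
  rw [Real.log_div hy.ne' hx.ne'] at h
  rw [Real.log_div hy.ne' hε.ne', Real.log_div hx.ne' hε.ne', sub_div, div_self hx.ne']
  linarith

/-- If `o` exceeds `(s + c) / r`, then `r * o - s` exceeds `c`, and the first term of the potential
drops by exactly `c`. The second term pays for the gain because `s + c ≤ a`. -/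
theorem charge_step {c s o a r φ φ' g : ℝ} (hc : 0 < c) (hr : 0 < r) (hta : s + c ≤ a)
    (hg : 0 ≤ g) (hφ : g + φ' ≤ φ) (ha : 0 ≤ a) :
    c * (if o ≤ (s + c) / r then 0 else 1) + (s + c) / r * g +
      (max 0 (r * o - (s + c)) + a / r * φ') ≤ max 0 (r * o - s) + a / r * φ := by
  have h1 : (s + c) / r * g ≤ a / r * g := by gcongr
  have h2 : a / r * (g + φ') ≤ a / r * φ := by gcongr
  have h3 : c * (if o ≤ (s + c) / r then 0 else 1) + max 0 (r * o - (s + c)) ≤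
      max 0 (r * o - s) := by
    split_ifs with h
    · rw [le_div_iff₀ hr] at h
      rw [max_eq_left (by linarith)]
      simp
    · rw [not_le, div_lt_iff₀ hr] at h
      rw [max_eq_right (by linarith), max_eq_right (by linarith)]
      linarith
  rw [mul_add] at h2
  linarith

theorem sum_split_children (P : Instance U I) (H : Finset I) (e : U) (A : Finset U)
    (F : I → ℝ) [DecidablePred fun i => P.Covers i A] :
    ∑ i ∈ H, F i = ∑ i ∈ P.uncovered A (P.yesPart H e), F i +
      ∑ i ∈ P.uncovered A (P.noPart H e), F i + ∑ i ∈ H with P.Covers i A, F i := by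
  classical
  rw [← Finset.sum_filter_add_sum_filter_not H (fun i => P.Covers i A) F,
    ← Finset.sum_filter_add_sum_filter_not (H.filter fun i => ¬ P.Covers i A)
      (fun i => e ∈ P.interest i) F, add_comm]
  congr 2
  · refine Finset.sum_congr ?_ fun _ _ => rfl
    ext i; simp only [mem_uncovered, yesPart, Finset.mem_filter]; tauto
  · refine Finset.sum_congr ?_ fun _ _ => rfl
    ext i; simp only [mem_uncovered, noPart, Finset.mem_filter]; tauto

/-- The right side is a potential bounding all future charges. `a i` is the full greedy cost, not
the cost from this state on, so it stays fixed in the induction and dominates every later time `t`.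
-/
theorem greedyFrom_cost_le (P : Instance U I) {ε : ℝ} (hε : 0 < ε)
    (hgap : ∀ i A, ¬ P.Covers i A → ε ≤ 1 - P.f i A) {T : DecisionTree U} (hT : P.Feasible T)
    {r : ℝ} (hr : 0 < r) (a : I → ℝ) {E : Finset U} {H : Finset I} {G : DecisionTree U}
    (hG : P.GreedyFrom E H G) (s : ℝ) (hs : 0 ≤ s) (hH : ∀ i ∈ H, ¬ P.Covers i E)
    (hom : ∀ e ∈ E, ∀ i ∈ H, ∀ j ∈ H, e ∈ P.interest i ↔ e ∈ P.interest j)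
    (ha : ∀ i ∈ H, a i = s + P.costFrom i E (G.path (P.interest i))) :
    ∑ i ∈ H, P.prob i * (a i - s) ≤ ∑ i ∈ H, P.prob i * (max 0 (r * P.scenarioCost T i - s) +
      a i / r * (2 * Real.log H.card + 1 + Real.log ((1 - P.f i E) / ε))) := by
  classical
  induction hG generalizing s with
  | done E => simp
  | step E H e yes no hne he _ _ ihy ihn =>
    obtain ⟨L, hL, heE, hmax⟩ := he
    have hc := P.cost_pos e
    have ha' : ∀ i ∈ H, a i = (s + P.cost e) + P.costFrom i (insert e E)
        ((if e ∈ P.interest i then yes else no).path (P.interest i)) := by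
      intro i hi
      rw [ha i hi, DecisionTree.path, costFrom, if_neg (hH i hi), add_assoc]
      split_ifs <;> rfl
    have hta : ∀ i ∈ H, s + P.cost e ≤ a i := fun i hi => by
      rw [ha' i hi]
      linarith [P.costFrom_nonneg i (insert e E)
        ((if e ∈ P.interest i then yes else no).path (P.interest i))]
    have ysub : P.uncovered (insert e E) (P.yesPart H e) ⊆ H := fun i hi =>
      (Finset.mem_filter.1 (mem_uncovered.1 hi).1).1
    have nsub : P.uncovered (insert e E) (P.noPart H e) ⊆ H := fun i hi =>
      (Finset.mem_filter.1 (mem_uncovered.1 hi).1).1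
    have iy := ihy (s + P.cost e) (by linarith) (fun i hi => (mem_uncovered.1 hi).2)
      (by
        intro e' he' i hi j hj
        rcases Finset.mem_insert.1 he' with rfl | he'
        · exact iff_of_true (Finset.mem_filter.1 (mem_uncovered.1 hi).1).2
            (Finset.mem_filter.1 (mem_uncovered.1 hj).1).2
        · exact hom e' he' i (ysub hi) j (ysub hj))
      (fun i hi => by
        rw [ha' i (ysub hi), if_pos (Finset.mem_filter.1 (mem_uncovered.1 hi).1).2])
    have ino := ihn (s + P.cost e) (by linarith) (fun i hi => (mem_uncovered.1 hi).2)
      (by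
        intro e' he' i hi j hj
        rcases Finset.mem_insert.1 he' with rfl | he'
        · exact iff_of_false (Finset.mem_filter.1 (mem_uncovered.1 hi).1).2
            (Finset.mem_filter.1 (mem_uncovered.1 hj).1).2
        · exact hom e' he' i (nsub hi) j (nsub hj))
      (fun i hi => by
        rw [ha' i (nsub hi), if_neg (Finset.mem_filter.1 (mem_uncovered.1 hi).1).2])
    set t := s + P.cost e with ht
    let g : I → ℝ := fun i => (if i ∈ L e then 1 else 0) +
      (P.f i (insert e E) - P.f i E) / (1 - P.f i E)
    have hg : ∀ i, 0 ≤ g i := fun i =>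
      add_nonneg (by split_ifs <;> norm_num) (P.gain_nonneg i E e)
    let D : I → ℝ := fun i => P.prob i *
      (P.cost e * (if P.scenarioCost T i ≤ t / r then 0 else 1) + t / r * g i)
    -- The charges `D` pay for displaying `e` to all of `H`.
    have hD : ∑ i ∈ H, P.prob i * P.cost e ≤ ∑ i ∈ H, D i := by
      have h := P.sum_prob_le_mul_score hH hom hL (P.score_nonneg E H (L e) e) hmax hT
        (B := t / r) (by positivity)
      have h' := mul_le_mul_of_nonneg_left h hc.le
      rw [mul_left_comm, P.cost_mul_score E e (hL e).subset, Finset.mul_sum, Finset.mul_sum,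
        Finset.sum_filter] at h'
      have e1 : ∑ i ∈ H, P.prob i * P.cost e =
          ∑ i ∈ H, (if P.scenarioCost T i ≤ t / r then P.cost e * P.prob i else 0) +
          ∑ i ∈ H, P.prob i * (P.cost e * (if P.scenarioCost T i ≤ t / r then 0 else 1)) := by
        rw [← Finset.sum_add_distrib]
        refine Finset.sum_congr rfl fun i _ => ?_
        split_ifs <;> ring
      have e2 : ∑ i ∈ H, D i =
          ∑ i ∈ H, P.prob i * (P.cost e * (if P.scenarioCost T i ≤ t / r then 0 else 1)) +
          ∑ i ∈ H, t / r * (P.prob i * g i) := by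
        rw [← Finset.sum_add_distrib]
        exact Finset.sum_congr rfl fun i _ => by simp only [D]; ring
      rw [e1, e2]
      linarith
    have hstep : ∀ i ∈ H, ∀ φ', g i + φ' ≤ 2 * Real.log H.card + 1 +
        Real.log ((1 - P.f i E) / ε) →
        D i + P.prob i * (max 0 (r * P.scenarioCost T i - t) + a i / r * φ') ≤
        P.prob i * (max 0 (r * P.scenarioCost T i - s) +
          a i / r * (2 * Real.log H.card + 1 + Real.log ((1 - P.f i E) / ε))) := by
      intro i hi φ' hφ
      simp only [D]
      rw [← mul_add]
      exact mul_le_mul_of_nonneg_left (charge_step hc hr (hta i hi) (hg i) hφ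
        (by linarith [hta i hi])) (P.prob_nonneg i)
    have hpos : ∀ i ∈ H, 0 < 1 - P.f i E := fun i hi =>
      hε.trans_le (hgap i E (hH i hi))
    have hcard := P.card_yesPart_add_card_noPart H e
    have hphi : ∀ i ∈ H, ¬ P.Covers i (insert e E) → ∀ H' : Finset I, i ∈ H' → H' ⊆ H →
        (i ∈ L e → 2 * H'.card ≤ H.card) →
        g i + (2 * Real.log H'.card + 1 + Real.log ((1 - P.f i (insert e E)) / ε)) ≤
          2 * Real.log H.card + 1 + Real.log ((1 - P.f i E) / ε) := by
      intro i hi hun H' hiH' hsub hhalf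
      have h1 := two_mul_log_card_le (l := if i ∈ L e then 1 else 0)
        (Finset.card_pos.2 ⟨i, hiH'⟩) (Finset.card_le_card hsub)
        (by
          by_cases hiL : i ∈ L e
          · exact Or.inr ⟨if_pos hiL, hhalf hiL⟩
          · exact Or.inl (if_neg hiL))
      have h2 := log_add_gain_le (hpos i hi) (hε.trans_le (hgap i _ hun)) hε
      have h3 : (1 - P.f i E) - (1 - P.f i (insert e E)) =
        P.f i (insert e E) - P.f i E := by ring
      rw [h3] at h2
      simp only [g]
      linarith
    have hy : ∀ i ∈ P.uncovered (insert e E) (P.yesPart H e), D i + P.prob i *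
        (max 0 (r * P.scenarioCost T i - t) + a i / r *
          (2 * Real.log (P.uncovered (insert e E) (P.yesPart H e)).card + 1 +
            Real.log ((1 - P.f i (insert e E)) / ε))) ≤
        P.prob i * (max 0 (r * P.scenarioCost T i - s) +
          a i / r * (2 * Real.log H.card + 1 + Real.log ((1 - P.f i E) / ε))) := by
      intro i hi
      have hm := mem_uncovered.1 hi
      refine hstep i (ysub hi) _ (hphi i (ysub hi) hm.2 _ hi ysub fun hiL => ?_)
      have hcle : (P.uncovered (insert e E) (P.yesPart H e)).card ≤ (P.yesPart H e).card :=
        Finset.card_le_card fun j hj => (mem_uncovered.1 hj).1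
      rcases hL e with ⟨_, h⟩ | ⟨h', _⟩
      · omega
      · rw [h'] at hiL
        exact absurd (Finset.mem_filter.1 hm.1).2 (Finset.mem_filter.1 hiL).2
    have hn : ∀ i ∈ P.uncovered (insert e E) (P.noPart H e), D i + P.prob i *
        (max 0 (r * P.scenarioCost T i - t) + a i / r *
          (2 * Real.log (P.uncovered (insert e E) (P.noPart H e)).card + 1 +
            Real.log ((1 - P.f i (insert e E)) / ε))) ≤
        P.prob i * (max 0 (r * P.scenarioCost T i - s) +
          a i / r * (2 * Real.log H.card + 1 + Real.log ((1 - P.f i E) / ε))) := by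
      intro i hi
      have hm := mem_uncovered.1 hi
      refine hstep i (nsub hi) _ (hphi i (nsub hi) hm.2 _ hi nsub fun hiL => ?_)
      have hcle : (P.uncovered (insert e E) (P.noPart H e)).card ≤ (P.noPart H e).card :=
        Finset.card_le_card fun j hj => (mem_uncovered.1 hj).1
      rcases hL e with ⟨h', _⟩ | ⟨_, h⟩
      · rw [h'] at hiL
        exact absurd (Finset.mem_filter.1 hiL).2 (Finset.mem_filter.1 hm.1).2
      · omega
    have hcv : ∀ i ∈ H.filter (fun i => P.Covers i (insert e E)), D i ≤
        P.prob i * (max 0 (r * P.scenarioCost T i - s) +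
          a i / r * (2 * Real.log H.card + 1 + Real.log ((1 - P.f i E) / ε))) := by
      intro i hi
      obtain ⟨hi, hci⟩ := Finset.mem_filter.1 hi
      -- A scenario covered now has no future charges, so its remaining potential is 0. Its last
      -- relative gain, at most 1, is paid by the summand 1, as the logarithm has no later deficit
      -- to telescope to.
      refine le_trans (le_add_of_nonneg_right ?_) (hstep i hi 0 ?_)
      · exact mul_nonneg (P.prob_nonneg i) (by simp)
      · have h1 := two_mul_log_card_le (h := H.card) (h' := 1)
          (l := if i ∈ L e then 1 else 0) one_pos (Finset.card_pos.2 ⟨i, hi⟩)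
          (by
            by_cases hiL : i ∈ L e
            · refine Or.inr ⟨if_pos hiL, ?_⟩
              have : 0 < (L e).card := Finset.card_pos.2 ⟨i, hiL⟩
              -- The smaller part is nonempty, so `H` has at least two members.
              rcases hL e with ⟨h', h⟩ | ⟨h', h⟩ <;> rw [h'] at this <;> omega
            · exact Or.inl (if_neg hiL))
        have h2 : 0 ≤ Real.log ((1 - P.f i E) / ε) :=
          Real.log_nonneg ((one_le_div hε).2 (hgap i E (hH i hi)))
        have h3 : (P.f i (insert e E) - P.f i E) / (1 - P.f i E) ≤ 1 :=
          (div_le_one (hpos i hi)).2 (by linarith [P.f_le_one i (insert e E)])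
        simp only [Nat.cast_one, Real.log_one] at h1
        simp only [g]
        linarith
    have hy' := Finset.sum_le_sum hy
    have hn' := Finset.sum_le_sum hn
    have hcv' := Finset.sum_le_sum hcv
    rw [Finset.sum_add_distrib] at hy' hn'
    have hzero : ∑ i ∈ H with P.Covers i (insert e E), P.prob i * (a i - t) = 0 := by
      refine Finset.sum_eq_zero fun i hi => ?_
      obtain ⟨hi, hci⟩ := Finset.mem_filter.1 hi
      rw [ha' i hi, costFrom_of_covers P hci]
      ring
    have hw : ∑ i ∈ H, P.prob i * (a i - s) =
        ∑ i ∈ H, P.prob i * P.cost e + ∑ i ∈ H, P.prob i * (a i - t) := by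
      rw [← Finset.sum_add_distrib]
      exact Finset.sum_congr rfl fun i _ => by rw [ht]; ring
    rw [hw, P.sum_split_children H e (insert e E) (fun i => P.prob i * (a i - t)), hzero,
      P.sum_split_children H e (insert e E) (fun i => P.prob i *
        (max 0 (r * P.scenarioCost T i - s) +
          a i / r * (2 * Real.log H.card + 1 + Real.log ((1 - P.f i E) / ε))))]
    rw [P.sum_split_children H e (insert e E) D] at hD
    linarith

/-! ### Feasibility of greedy trees -/

theorem GreedyFrom.covers {P : Instance U I} {E : Finset U} {H : Finset I} {G : DecisionTree U}
    (hG : P.GreedyFrom E H G) :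
    ∀ i ∈ H, P.Covers i (E ∪ (G.path (P.interest i)).toFinset) := by
  induction hG with
  | done E => simp
  | step E H e yes no _ _ _ _ ihy ihn =>
    intro i hi
    have hu : ∀ k : List U, E ∪ (e :: k).toFinset = insert e E ∪ k.toFinset := fun k => by
      ext x; simp only [List.toFinset_cons, Finset.mem_union, Finset.mem_insert]; tauto
    rw [DecisionTree.path, hu]
    by_cases hc : P.Covers i (insert e E)
    · exact hc.mono Finset.subset_union_left
    · split_ifs with he
      · exact ihy i (mem_uncovered.2 ⟨Finset.mem_filter.2 ⟨hi, he⟩, hc⟩)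
      · exact ihn i (mem_uncovered.2 ⟨Finset.mem_filter.2 ⟨hi, he⟩, hc⟩)

theorem IsGreedyTree.feasible {P : Instance U I} {G : DecisionTree U} (hG : P.IsGreedyTree G) :
    P.Feasible G := fun i => by
  simpa using GreedyFrom.covers hG i (Finset.mem_univ i)

end General

/-! ### Existence of greedy trees, the smallest gain, and the final bound -/

section Finite

variable {U I : Type*} [DecidableEq U] [Fintype U] [Fintype I]

theorem exists_isGreedyChoice (P : Instance U I) {E : Finset U} (hE : E ≠ Finset.univ)
    (H : Finset I) : ∃ e, P.IsGreedyChoice E H e := by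
  have hL : ∀ e, ∃ L, P.IsSmallerPart H e L := fun e =>
    (le_total (P.yesPart H e).card (P.noPart H e).card).elim
      (fun h => ⟨_, Or.inl ⟨rfl, h⟩⟩) (fun h => ⟨_, Or.inr ⟨rfl, h⟩⟩)
  choose L hL using hL
  obtain ⟨e, he, hmax⟩ := Finset.exists_max_image Eᶜ (fun e => P.score E H (L e) e)
    (by rwa [Finset.nonempty_iff_ne_empty, Ne, Finset.compl_eq_empty_iff])
  exact ⟨e, L, hL, Finset.mem_compl.1 he, fun e' he' => hmax e' (Finset.mem_compl.2 he')⟩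

/-- Each display shrinks the complement of `E`, and an uncovered scenario guarantees that some
element remains. -/
theorem exists_greedyFrom (P : Instance U I) (E : Finset U) (H : Finset I)
    (hH : ∀ i ∈ H, ¬ P.Covers i E) : ∃ G, P.GreedyFrom E H G := by
  induction hk : Eᶜ.card using Nat.strong_induction_on generalizing E H with
  | _ k ih =>
    rcases H.eq_empty_or_nonempty with rfl | hne
    · exact ⟨_, .done E⟩
    · have hE : E ≠ Finset.univ := by
        rintro rfl
        obtain ⟨i, hi⟩ := hne
        exact hH i hi (P.covers_of_interest_subset (Finset.subset_univ _))
      obtain ⟨e, he⟩ := P.exists_isGreedyChoice hE H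
      have hlt : (insert e E)ᶜ.card < k := by
        obtain ⟨_, _, heE, _⟩ := he
        rw [← hk]
        exact Finset.card_lt_card (Finset.compl_ssubset_compl.2 (Finset.ssubset_insert heE))
      obtain ⟨y, hy⟩ := ih _ hlt (insert e E) (P.uncovered (insert e E) (P.yesPart H e))
        (fun i hi => (mem_uncovered.1 hi).2) rfl
      obtain ⟨n, hn⟩ := ih _ hlt (insert e E) (P.uncovered (insert e E) (P.noPart H e))
        (fun i hi => (mem_uncovered.1 hi).2) rfl
      exact ⟨_, .step E H e y n hne he hy hn⟩

/-- An uncovered scenario lacks at least the smallest gain. -/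
theorem minGain_le_of_not_covers (P : Instance U I) (i : I) (A : Finset U)
    (h : ¬ P.Covers i A) : P.minGain ≤ 1 - P.f i A := by
  obtain ⟨e, he⟩ : ∃ e, P.f i A < P.f i (insert e A) := by
    by_contra! hcon
    have h1 := P.gain_union_le i A (P.interest i)
    have h2 : ∑ e ∈ P.interest i, (P.f i (insert e A) - P.f i A) ≤ 0 :=
      Finset.sum_nonpos fun e _ => sub_nonpos.2 (hcon e)
    have h3 : P.Covers i (A ∪ P.interest i) :=
      P.covers_of_interest_subset Finset.subset_union_right
    rw [Covers] at h h3
    linarith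
  have hle : P.minGain ≤ P.f i (insert e A) - P.f i A :=
    csInf_le ⟨0, by rintro x ⟨_, _, _, hlt, rfl⟩; linarith⟩ ⟨i, A, e, he, rfl⟩
  linarith [P.f_le_one i (insert e A)]

theorem minGain_pos (P : Instance U I) : 0 < P.minGain := by
  let F : I × Finset U × U → ℝ := fun x => P.f x.1 (insert x.2.2 x.2.1) - P.f x.1 x.2.1
  have hfin : {x : ℝ | ∃ (i : I) (A : Finset U) (e : U),
      P.f i A < P.f i (insert e A) ∧ x = P.f i (insert e A) - P.f i A}.Finite := by
    refine (Set.finite_range F).subset ?_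
    rintro x ⟨i, A, e, _, rfl⟩
    exact ⟨(i, A, e), rfl⟩
  have hne : {x : ℝ | ∃ (i : I) (A : Finset U) (e : U),
      P.f i A < P.f i (insert e A) ∧ x = P.f i (insert e A) - P.f i A}.Nonempty := by
    obtain ⟨i⟩ : Nonempty I := by
      by_contra h
      rw [not_nonempty_iff] at h
      simpa using P.prob_sum
    by_contra hemp
    rw [Set.not_nonempty_iff_eq_empty] at hemp
    have h1 := P.gain_union_le i ∅ (P.interest i)
    have h2 : ∑ e ∈ P.interest i, (P.f i (insert e ∅) - P.f i ∅) ≤ 0 := by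
      refine Finset.sum_nonpos fun e _ => ?_
      by_contra! hlt
      have : P.f i (insert e ∅) - P.f i ∅ ∈ (∅ : Set ℝ) := by
        rw [← hemp]
        exact ⟨i, ∅, e, sub_pos.1 hlt, rfl⟩
      exact this
    rw [Finset.empty_union, P.f_interest, P.f_empty] at h1
    rw [P.f_empty] at h2
    linarith
  obtain ⟨i, A, e, hlt, hx⟩ := hne.csInf_mem hfin
  rw [minGain, hx]
  exact sub_pos.2 hlt

theorem IsGreedyTree.expectedCost_le {P : Instance U I} {G : DecisionTree U}
    (hG : P.IsGreedyTree G) {T : DecisionTree U} (hT : P.Feasible T) :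
    P.expectedCost G ≤ 8 * (1 + Real.log (1 / P.minGain) + Real.log (Fintype.card I)) *
      P.expectedCost T := by
  have hε := P.minGain_pos
  obtain ⟨i₀⟩ : Nonempty I := by
    by_contra h
    rw [not_nonempty_iff] at h
    simpa using P.prob_sum
  have hε1 : P.minGain ≤ 1 := by
    simpa [P.f_empty] using P.minGain_le_of_not_covers i₀ ∅ (P.not_covers_empty i₀)
  have hlogε : 0 ≤ Real.log (1 / P.minGain) := Real.log_nonneg ((one_le_div hε).2 hε1)
  have hlogm : 0 ≤ Real.log (Fintype.card I) := Real.log_natCast_nonneg _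
  set K := 1 + Real.log (1 / P.minGain) + Real.log (Fintype.card I) with hK
  have hKpos : 0 < K := by positivity
  have hcost : ∀ {T' : DecisionTree U}, P.Feasible T' → ∀ i, 0 ≤ P.scenarioCost T' i :=
    fun h i => by rw [P.scenarioCost_eq_costFrom h]; exact P.costFrom_nonneg _ _ _
  -- The initial gain potential is at most `2 * K`, so `r = 4 * K` leaves half of each greedy cost
  -- on the right; absorbing it doubles `4 * K` to `8 * K`.
  have hmain := P.greedyFrom_cost_le hε P.minGain_le_of_not_covers hT (r := 4 * K)
    (by positivity) (P.scenarioCost G) hG 0 le_rfl (fun i _ => P.not_covers_empty i) (by simp)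
    (fun i _ => by rw [P.scenarioCost_eq_costFrom hG.feasible, zero_add])
  have hle : ∑ i, P.prob i * (max 0 (4 * K * P.scenarioCost T i - 0) +
      P.scenarioCost G i / (4 * K) * (2 * Real.log (Finset.univ : Finset I).card + 1 +
        Real.log ((1 - P.f i ∅) / P.minGain))) ≤
      ∑ i, P.prob i * (4 * K * P.scenarioCost T i + P.scenarioCost G i / 2) := by
    refine Finset.sum_le_sum fun i _ => mul_le_mul_of_nonneg_left ?_ (P.prob_nonneg i)
    have h0 := hcost hG.feasible i
    have h1 := hcost hT i
    rw [sub_zero, max_eq_right (by positivity), P.f_empty, sub_zero, Finset.card_univ]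
    have h2 : P.scenarioCost G i / (4 * K) * (2 * Real.log (Fintype.card I) + 1 +
        Real.log (1 / P.minGain)) ≤ P.scenarioCost G i / (4 * K) * (2 * K) :=
      mul_le_mul_of_nonneg_left (by rw [hK]; linarith) (by positivity)
    have h3 : P.scenarioCost G i / (4 * K) * (2 * K) = P.scenarioCost G i / 2 := by
      field_simp
      norm_num
    linarith
  have hsum : ∑ i, P.prob i * (4 * K * P.scenarioCost T i + P.scenarioCost G i / 2) =
      4 * K * P.expectedCost T + P.expectedCost G / 2 := by
    simp only [expectedCost, Finset.mul_sum, Finset.sum_div]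
    rw [← Finset.sum_add_distrib]
    exact Finset.sum_congr rfl fun i _ => by ring
  have hA : ∑ i, P.prob i * (P.scenarioCost G i - 0) = P.expectedCost G := by
    simp [expectedCost]
  rw [hA] at hmain
  linarith

end Finite

end Instance

end ASR

theorem theorem1 :
    ∃ C : ℝ, 0 < C ∧ ∀ (n m : ℕ) (P : ASR.Instance (Fin n) (Fin m)),
      (∃ G, P.IsGreedyTree G) ∧
      ∀ G, P.IsGreedyTree G →
        P.Feasible G ∧
        ∀ T, P.Feasible T →
          P.expectedCost G ≤
            C * (1 + Real.log (1 / P.minGain) + Real.log m) * P.expectedCost T := by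
  refine ⟨8, by norm_num, fun n m P =>
    ⟨P.exists_greedyFrom ∅ Finset.univ fun i _ => P.not_covers_empty i,
      fun G hG => ⟨hG.feasible, fun T hT => ?_⟩⟩⟩
  simpa using hG.expectedCost_le hT
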